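/- Let $\mathbb K$ be an algebraically closed field of characteristic $0$ with a nontrivial valuation $\mathrm{val}:\mathbb K\to\mathbb R\cup\{\infty\}$ whose residue field has characteristic $0$. Let $A\subset\mathbb Z^d$ be finite, let $p=(p_i)_{i\in A}$ be real numbers lying in the image of $\mathrm{val}$, and let $f(w)=\min_{i\in A}(p_i+\langle i,w\rangle)$ be the tropical polynomial with support $A$ and coefficients $p$. Let $\mathcal T(f)\subset\mathbb R^d$ be the set of points at which this minimum is attained at least twice. A point $q\in\mathcal T(f)$ is *singular* if there are a Laurent polynomial $F=\sum_{i\in A}a_ix^i$ over $\mathbb K$ with $\mathrm{val}(a_i)=p_i$ for all $i\in A$ and a point $b\in(\mathbb K^*)^d$ with $\mathrm{val}(b)=q$ such that $F$ and all its first partial derivatives vanish at $b$; $\mathcal T(f)$ is *singular* if it has a singular point. A *marked cell* of the coherent subdivision $\Pi_p$ of the convex hull $N(A)$ is a nonempty set $\sigma=\{i\in A: p_i=\varphi(i)\}$, where $\varphi$ is a real affine function with $\varphi(i)\le p_i$ for all $i\in A$. Its *dual cell* $\sigma^*$ is the closure of the set of points of $\mathcal T(f)$ at which the minimum is attained exactly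 on $\sigma$. A *circuit* is a minimal affinely dependent set of points. **Proposition.** Let $\sigma'$ be a marked cell of $\Pi_p$ of dimension $d$ that is a pyramid over a point $i_1$ (that is, $i_1\in\sigma'$ does not lie in the affine span of $\sigma'\setminus\{i_1\}$), and let $Z$ be a circuit of dimension $d-1$ contained in $\sigma'$. Let $L(w)=j_1w_1+\dots+j_dw_d+\beta$ be an affine function with integer coefficients that vanishes on $Z$ and satisfies $L(i_1)>0$, and let $v$ be the vertex of $\mathcal T(f)$ dual to $\sigma'$, so that $\{v\}=(\sigma')^*$. Then there exists a singular point $q$ of $\mathcal T(f)$ in the dual cell $(\sigma'\cap\{L=0\})^*$ with $\langle q-v,\,i_1-z\rangle>0$ for all $z\in Z$ if and only if there exists $i_2\in A\setminus\sigma'$ with $L(i_2)\ne0$ and $L(i_2)<L(i_1)$. (If coordinates are chosen so that $v=0$ and $L(0)=0$, the inequality for $q$ reads $\langle q,i_1\rangle>0$.) In particular, if the convex hull of $Z$ meets the interior of $N(A)$, then $\mathcal T(f)$ is singular. -/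

import Mathlib

namespace TropSing

noncomputable section

/-- The standard pairing `⟨i, w⟩` of a lattice point `i ∈ ℤ^d` with `w ∈ ℝ^d`. -/
def pair {d : ℕ} (i : Fin d → ℤ) (w : Fin d → ℝ) : ℝ := ∑ k, (i k : ℝ) * w k

/-- The inclusion `ℤ^d ⊆ ℝ^d`. -/
def toReal {d : ℕ} (i : Fin d → ℤ) : Fin d → ℝ := fun k => (i k : ℝ)

/-- The dimension of the real affine span of a set of lattice points
(meaningful for nonempty sets). -/
def affDim {d : ℕ} (S : Set (Fin d → ℤ)) : ℕ :=
  Module.finrank ℝ (vectorSpan ℝ (toReal '' S))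

/-! ## Tropical polynomials

A tropical polynomial `f = ⨁_{i ∈ A} p_i ⊙ w^i` with finite support `A` is given by `A` and
its coefficients `p`; only the values of `p` on `A` matter. -/

/-- The tropical monomial `p_i ⊙ w^i = p_i + ⟨i, w⟩`. -/
def tropTerm {d : ℕ} (p : (Fin d → ℤ) → ℝ) (i : Fin d → ℤ) (w : Fin d → ℝ) : ℝ :=
  p i + pair i w

/-- The value `f(w) = min_{i ∈ A} (p_i + ⟨i, w⟩)` in `ℝ ∪ {∞}`. -/
def tropEval {d : ℕ} (A : Finset (Fin d → ℤ)) (p : (Fin d → ℤ) → ℝ) (w : Fin d → ℝ) :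
    WithTop ℝ :=
  A.inf fun i => ((tropTerm p i w : ℝ) : WithTop ℝ)

/-- The set of all `i ∈ A` at which the minimum `f(w)` is attained. -/
def minSupport {d : ℕ} (A : Finset (Fin d → ℤ)) (p : (Fin d → ℤ) → ℝ) (w : Fin d → ℝ) :
    Set (Fin d → ℤ) :=
  {i | i ∈ A ∧ tropEval A p w = ((tropTerm p i w : ℝ) : WithTop ℝ)}

/-- The tropical hypersurface `𝒯(f)`: the minimum is attained at two different points. -/
def tropHypersurface {d : ℕ} (A : Finset (Fin d → ℤ)) (p : (Fin d → ℤ) → ℝ) :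
    Set (Fin d → ℝ) :=
  {w | ∃ i ∈ minSupport A p w, ∃ j ∈ minSupport A p w, i ≠ j}

/-! ## The coherent marked subdivision and its dual cells -/

/-- `σ` is a marked cell of the coherent marked subdivision `Π_p` of the convex hull of `A`:
for some affine function `φ(w) = ⟨c, w⟩ + β` with `φ ≤ p` on `A`, it is the (nonempty) set of
all `i ∈ A` with `p_i = φ(i)`. -/
def IsMarkedCell {d : ℕ} (A : Finset (Fin d → ℤ)) (p : (Fin d → ℤ) → ℝ)
    (σ : Set (Fin d → ℤ)) : Prop :=
  σ.Nonempty ∧ ∃ (c : Fin d → ℝ) (β : ℝ),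
    (∀ i ∈ A, pair i c + β ≤ p i) ∧ σ = {i | i ∈ A ∧ p i = pair i c + β}

/-- The dual cell `σ^*` in `𝒯(f)`: the closure of the set of those points of `𝒯(f)` at which
the minimum is attained exactly at the points of `σ`. -/
def dualCell {d : ℕ} (A : Finset (Fin d → ℤ)) (p : (Fin d → ℤ) → ℝ)
    (σ : Set (Fin d → ℤ)) : Set (Fin d → ℝ) :=
  closure {w | w ∈ tropHypersurface A p ∧ minSupport A p w = σ}

/-- A circuit: a minimal affinely dependent set of lattice points. -/
def IsCircuit {d : ℕ} (Z : Set (Fin d → ℤ)) : Prop :=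
  (¬ AffineIndependent ℝ fun i : Z => toReal i.1) ∧
    ∀ Z' : Set (Fin d → ℤ), Z' ⊂ Z → AffineIndependent ℝ fun i : Z' => toReal i.1

/-- The configuration `S` is a pyramid over its point `x`: the remaining points lie in an
affine subspace that does not contain `x`. -/
def IsPyramidOver {d : ℕ} (S : Set (Fin d → ℤ)) (x : Fin d → ℤ) : Prop :=
  x ∈ S ∧ toReal x ∉ affineSpan ℝ (toReal '' (S \ {x}))

/-- An integral affine function `L(w) = j_1 w_1 + ⋯ + j_d w_d + β`. -/
structure IntAffine (d : ℕ) where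
  /-- the coefficients `j_1, …, j_d` -/
  lin : Fin d → ℤ
  /-- the constant term `β` -/
  const : ℤ

/-- The value of an integral affine function at a lattice point. -/
def IntAffine.eval {d : ℕ} (L : IntAffine d) (i : Fin d → ℤ) : ℤ :=
  ∑ k, L.lin k * i k + L.const

/-! ## Laurent polynomials and singular points

`AddMonoidAlgebra K (Fin d → ℤ)` is the ring of Laurent polynomials `K[x_1^{±1}, …, x_d^{±1}]`. -/

/-- The value `∑_i a_i b^i` of a Laurent polynomial at a point `b` of the torus `(K^*)^d`. -/
def laurentEval {d : ℕ} {K : Type*} [Field K] (b : Fin d → Kˣ)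
    (F : AddMonoidAlgebra K (Fin d → ℤ)) : K :=
  F.coeff.sum fun i a => a * ((∏ k, b k ^ i k : Kˣ) : K)

/-- The partial derivative `∂/∂x_k` of a Laurent polynomial:
`∑_i a_i x^i ↦ ∑_i i_k a_i x^{i - e_k}`. -/
def laurentDeriv {d : ℕ} {K : Type*} [Field K] (k : Fin d)
    (F : AddMonoidAlgebra K (Fin d → ℤ)) : AddMonoidAlgebra K (Fin d → ℤ) :=
  F.coeff.sum fun i a => AddMonoidAlgebra.single (i - Pi.single k 1) ((i k : K) * a)

/-- `b ∈ (K^*)^d` is a singular point of the hypersurface `V(F)`. -/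
def IsSingularZero {d : ℕ} {K : Type*} [Field K] (F : AddMonoidAlgebra K (Fin d → ℤ))
    (b : Fin d → Kˣ) : Prop :=
  laurentEval b F = 0 ∧ ∀ k, laurentEval b (laurentDeriv k F) = 0

/-- `q ∈ 𝒯(f)` is a singular point of `𝒯(f)`: there are a Laurent polynomial `F` with support
`A` and coefficients of valuation `p_i`, and a singular point `b ∈ (K^*)^d` of `V(F)` with
`val(b) = q`. -/
def IsTropSingular {d : ℕ} {K : Type*} [Field K] (val : AddValuation K (WithTop ℝ))
    (A : Finset (Fin d → ℤ)) (p : (Fin d → ℤ) → ℝ) (q : Fin d → ℝ) : Prop :=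
  q ∈ tropHypersurface A p ∧
    ∃ (F : AddMonoidAlgebra K (Fin d → ℤ)) (b : Fin d → Kˣ),
      F.coeff.support = A ∧ (∀ i ∈ A, val (F.coeff i) = ((p i : ℝ) : WithTop ℝ)) ∧
      (∀ k, val (b k : K) = ((q k : ℝ) : WithTop ℝ)) ∧ IsSingularZero F b

end

end TropSing

namespace TropSing
open Finset

/-! ### Affine coordinates from a circuit of codimension one -/

section Circuits

variable {d : ℕ}

/-! Work with the terms `c_i = a_i b^i` of `F` at `b`. Vanishing of `F` and of its first derivatives
at `b` means `∑ c_i = 0` and `∑ i c_i = 0`, while `val (c_i)` is the tropical monomial of `i` at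
`q`. Removing a point `z₀` from the circuit `Z` leaves an affine basis `B` of the hyperplane `L =
0`, and `B` together with `i₁` is a rational affine basis of the whole space. The coordinate of `i`
at `i₁` is `r i = L(i)/L(i₁)`; minimality of the circuit makes every coordinate of `z₀` on `B`
nonzero (`exists_affine_coordinates`).

Necessity: the linear relations give `∑ L(i) c_i = 0`. Nonzero integers have valuation `0`, so `i₁`
cannot be the only minimum among the terms with `L(i) ≠ 0`; some `i₂ ≠ i₁` does at least as well at
`q`. The pyramid condition puts `i₂` outside `σ'`, so it was strictly worse at `v`. Between `v` and
`q` the monomials change by a positive multiple of `r i`, up to a common shift, hence `r i₂ < 1`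
(`exists_eval_lt_of_singular`).

Sufficiency: move from `v` along the linear part of `L` until the monomial of `i₁` is first caught
by some `i₂` with `L(i₂) ≠ 0` and `r i₂ < 1`. At this `q` the minimum is attained exactly on `σ' ∩
{L = 0}`, and `i₁`, `i₂` are tied for the lowest value off `L = 0`. The terms on `B ∪ {i₁}` are then
determined by the others, and generic choices at `i₂` and `z₀` give them the right valuations
(`exists_balanced_terms`). The value group is divisible, so `q` lies in the image of `val`.

For the last claim, if the hull of `Z` meets the interior of `N(A)` then `L` is negative somewhere
on `A`, and such a point serves as `i₂`. -/

theorem weights_eq_zero_of_affineIndependent {T : Finset (Fin d → ℤ)} {S : Set (Fin d → ℤ)}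
    (hTS : ∀ z ∈ T, z ∈ S) (h : AffineIndependent ℝ fun i : S => toReal i.1)
    (w : (Fin d → ℤ) → ℝ) (h0 : ∑ z ∈ T, w z = 0)
    (h1 : ∀ k, ∑ z ∈ T, w z * (z k : ℝ) = 0) : ∀ z ∈ T, w z = 0 := by
  classical
  have key := affineIndependent_iff.1 h
    (T.attach.map (⟨fun x => ⟨x.1, hTS x.1 x.2⟩, fun x y hxy =>
      Subtype.ext (congrArg (fun u : S => u.1) hxy)⟩ : T ↪ S)) (fun x => w x.1)
  simp only [Finset.sum_map, Finset.mem_map, mem_attach, true_and,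
    forall_exists_index] at key
  have a := key (by rw [← h0]; exact Finset.sum_attach T w) (by
    refine (Finset.sum_attach T (fun z => w z • toReal z)).trans ?_
    ext k
    simpa [toReal] using h1 k)
  intro z hz
  exact a ⟨z, hTS z hz⟩ ⟨z, hz⟩ rfl

theorem IsCircuit.nontrivial {Z : Set (Fin d → ℤ)} (hZ : IsCircuit Z) : Z.Nontrivial := by
  by_contra h
  rw [Set.not_nontrivial_iff] at h
  have := h.coe_sort
  exact hZ.1 (affineIndependent_of_subsingleton ℝ _)

/-- Otherwise adjoining `z₀` to the independent set `Z \ {z₀}` would keep it independent. -/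
theorem IsCircuit.mem_affineSpan {Z : Set (Fin d → ℤ)} (hZ : IsCircuit Z) {z₀ : Fin d → ℤ}
    (hz₀ : z₀ ∈ Z) : toReal z₀ ∈ affineSpan ℝ (toReal '' (Z \ {z₀})) := by
  by_contra h
  apply hZ.1
  have hss : Z \ {z₀} ⊂ Z := Set.sdiff_singleton_ssubset.2 hz₀
  have hind := hZ.2 _ hss
  refine AffineIndependent.affineIndependent_of_notMem_span (i := ⟨z₀, hz₀⟩) ?_ ?_
  · let e : {y : Z // y ≠ ⟨z₀, hz₀⟩} ↪ (Z \ {z₀} : Set (Fin d → ℤ)) :=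
      ⟨fun x => ⟨x.1.1, x.1.2, fun hx => x.2 (Subtype.ext hx)⟩, fun x y hxy => Subtype.ext
        (Subtype.ext (congrArg (fun u : (Z \ {z₀} : Set (Fin d → ℤ)) => u.1) hxy))⟩
    have := hind.comp_embedding e
    exact this
  · convert h using 2
    congr 1
    ext y
    constructor
    · rintro ⟨x, hx, rfl⟩
      exact ⟨x.1, ⟨x.2, fun hh => hx (Subtype.ext hh)⟩, rfl⟩
    · rintro ⟨x, hx, rfl⟩
      exact ⟨⟨x, hx.1⟩, fun hh => hx.2 (congrArg Subtype.val hh), rfl⟩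

/-- For a circuit of dimension `d - 1` this leaves `d` points, so that one point off the hyperplane
completes them to an affine basis. -/
theorem IsCircuit.card_erase {Z : Set (Fin d → ℤ)} (hZ : IsCircuit Z) {z₀ : Fin d → ℤ}
    (hz₀ : z₀ ∈ Z) (B : Finset (Fin d → ℤ)) (hB : (B : Set (Fin d → ℤ)) = Z \ {z₀}) :
    B.card = affDim Z + 1 := by
  classical
  have hmem := hZ.mem_affineSpan hz₀
  have hspan : vectorSpan ℝ (toReal '' Z) = vectorSpan ℝ (toReal '' (Z \ {z₀})) := by
    rw [← direction_affineSpan, ← direction_affineSpan,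
      ← affineSpan_insert_eq_affineSpan ℝ hmem, ← Set.image_insert_eq,
      Set.insert_sdiff_singleton, Set.insert_eq_of_mem hz₀]
  have hind := hZ.2 _ (Set.sdiff_singleton_ssubset.2 hz₀)
  rw [← hB] at hind hspan
  obtain ⟨y, hy, hne⟩ := hZ.nontrivial.exists_ne z₀
  have hyB : y ∈ B := by
    rw [← Finset.mem_coe, hB]; exact ⟨hy, hne⟩
  have : Nonempty (B : Set (Fin d → ℤ)) := ⟨⟨y, hyB⟩⟩
  have := hind.finrank_vectorSpan_add_one
  rw [affDim, hspan]
  have himg : toReal '' (B : Set (Fin d → ℤ)) =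
      Set.range fun i : (B : Set (Fin d → ℤ)) => toReal i.1 := Set.image_eq_range _ _
  rw [himg, this]
  simp

theorem IntAffine.sum_mul_eval (L : IntAffine d) (T : Finset (Fin d → ℤ))
    (w : (Fin d → ℤ) → ℚ) : ∑ z ∈ T, w z * (L.eval z : ℚ) =
      ∑ k, (L.lin k : ℚ) * ∑ z ∈ T, w z * (z k : ℚ) + L.const * ∑ z ∈ T, w z := by
  simp only [IntAffine.eval]
  push_cast
  simp only [mul_add, Finset.sum_add_distrib, Finset.mul_sum]
  rw [Finset.sum_comm]
  congr 1
  · exact Finset.sum_congr rfl fun _ _ => Finset.sum_congr rfl fun _ _ => by ring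
  · exact Finset.sum_congr rfl fun _ _ => by ring

theorem IntAffine.sum_mul_eval_add (L : IntAffine d) (T : Finset (Fin d → ℤ))
    (w : (Fin d → ℤ) → ℚ) (r : ℚ) (i₁ : Fin d → ℤ) :
    ∑ z ∈ T, w z * (L.eval z : ℚ) + r * L.eval i₁ =
      ∑ k, (L.lin k : ℚ) * (∑ z ∈ T, w z * (z k : ℚ) + r * i₁ k) +
        L.const * (∑ z ∈ T, w z + r) := by
  rw [L.sum_mul_eval]
  simp only [mul_add, Finset.sum_add_distrib, IntAffine.eval]
  push_cast
  simp only [mul_add, Finset.mul_sum, mul_left_comm r]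
  ring

/-- A circuit of codimension one minus one of its points, together with a point off its
hyperplane, is a rational affine basis of `ℚ^d`. -/
theorem exists_affine_coordinates {Z : Set (Fin d → ℤ)} (hZ : IsCircuit Z) (hfin : Z.Finite)
    (hdim : affDim Z + 1 = d) (L : IntAffine d) (hZL : ∀ z ∈ Z, L.eval z = 0)
    {i₁ : Fin d → ℤ} (hL : L.eval i₁ ≠ 0) :
    ∃ z₀ ∈ Z, ∃ B : Finset (Fin d → ℤ), (B : Set (Fin d → ℤ)) = Z \ {z₀} ∧
      ∃ μ : (Fin d → ℤ) → (Fin d → ℤ) → ℚ,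
        (∀ i, ∑ z ∈ B, μ i z + (L.eval i / L.eval i₁ : ℚ) = 1) ∧
        (∀ i k, ∑ z ∈ B, μ i z * (z k : ℚ) + (L.eval i / L.eval i₁ : ℚ) * i₁ k = i k) ∧
        ∀ z ∈ B, μ z₀ z ≠ 0 := by
  classical
  have hLq : (L.eval i₁ : ℚ) ≠ 0 := by exact_mod_cast hL
  obtain ⟨z₀, hz₀⟩ := hZ.nontrivial.nonempty
  obtain ⟨B, hB⟩ := (hfin.subset (Set.sdiff_subset (t := {z₀}))).exists_finset_coe
  have hBZ : ∀ z ∈ B, z ∈ Z ∧ z ≠ z₀ := fun z hz => by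
    rw [← Finset.mem_coe, hB] at hz; exact hz
  have hcard := hZ.card_erase hz₀ B hB
  rw [hdim] at hcard
  -- Homogenization: affine coordinates are linear coordinates for the vectors `(1, z)` in dimension
  -- `d + 1`.
  let h : Option B → ℚ × (Fin d → ℚ) := fun o =>
    o.elim (1, fun k => (i₁ k : ℚ)) (fun z => (1, fun k => (z.1 k : ℚ)))
  have hind : LinearIndependent ℚ h := by
    rw [Fintype.linearIndependent_iff]
    intro g hg
    rw [Fintype.sum_option] at hg
    have hg0 := congrArg Prod.fst hg
    have hg1 : ∀ k, _ := fun k => congrFun (congrArg Prod.snd hg) k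
    let w : (Fin d → ℤ) → ℚ := fun z => if hz : z ∈ B then g (some ⟨z, hz⟩) else 0
    have hsum : ∀ f : (Fin d → ℤ) → ℚ, ∑ x : B, g (some x) * f x.1 = ∑ z ∈ B, w z * f z := by
      intro f
      rw [← Finset.sum_coe_sort B]
      exact Finset.sum_congr rfl fun x _ => by simp [w]
    simp only [h, Option.elim, Prod.fst_add, Prod.smul_mk, Prod.fst_sum, Prod.snd_add,
      Prod.snd_sum, Pi.add_apply, Finset.sum_apply, Pi.smul_apply, smul_eq_mul,
      Prod.fst_zero, Prod.snd_zero, Pi.zero_apply] at hg0 hg1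
    rw [hsum (fun _ => 1)] at hg0
    simp only [mul_one] at hg0
    have hg1' : ∀ k, g none * (i₁ k : ℚ) + ∑ z ∈ B, w z * (z k : ℚ) = 0 := fun k => by
      rw [← hsum]; exact hg1 k
    -- Applying `L` to the relation kills every point of `B` and isolates the coefficient of `i₁`.
    have hnone : g none * L.eval i₁ = 0 := by
      have e := L.sum_mul_eval_add B w (g none) i₁
      simp only [add_comm _ (g none * _), hg1', add_comm _ (g none), hg0, mul_zero,
        Finset.sum_const_zero, add_zero] at e
      rwa [Finset.sum_eq_zero, add_zero] at e
      intro z hz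
      rw [hZL z (hBZ z hz).1]; simp
    have hn : g none = 0 := (mul_eq_zero.1 hnone).resolve_right hLq
    have hw := weights_eq_zero_of_affineIndependent (T := B) (S := Z \ {z₀})
      (fun z hz => hBZ z hz) (hZ.2 _ (Set.sdiff_singleton_ssubset.2 hz₀)) (fun z => (w z : ℝ))
      (by simp only [hn, zero_add] at hg0; exact_mod_cast hg0)
      (fun k => by
        have := hg1' k
        simp only [hn, zero_mul, zero_add] at this
        exact_mod_cast this)
    rintro (_ | ⟨z, hz⟩)
    · exact hn
    · have := hw z hz
      simpa [w, hz] using this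
  have hcardeq : Fintype.card (Option B) = Module.finrank ℚ (ℚ × (Fin d → ℚ)) := by
    simp [hcard, add_comm]
  let b := basisOfLinearIndependentOfCardEqFinrank hind hcardeq
  let μ : (Fin d → ℤ) → (Fin d → ℤ) → ℚ := fun i z =>
    if hz : z ∈ B then b.repr (1, fun k => (i k : ℚ)) (some ⟨z, hz⟩) else 0
  let r : (Fin d → ℤ) → ℚ := fun i => b.repr (1, fun k => (i k : ℚ)) none
  have hrep : ∀ i, r i • h none + ∑ x : B, μ i x.1 • h (some x) = (1, fun k => (i k : ℚ)) := by
    intro i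
    have := b.sum_repr (1, fun k => (i k : ℚ))
    rw [Fintype.sum_option] at this
    simpa [μ, r, b] using this
  have h0 : ∀ i, ∑ z ∈ B, μ i z + r i = 1 := fun i => by
    have := congrArg Prod.fst (hrep i)
    simp only [h, Option.elim, Prod.fst_add, Prod.smul_mk, Prod.fst_sum, smul_eq_mul,
      mul_one] at this
    rw [add_comm, ← this, ← Finset.sum_coe_sort B]
  have h1 : ∀ i k, ∑ z ∈ B, μ i z * (z k : ℚ) + r i * i₁ k = i k := fun i k => by
    have := congrFun (congrArg Prod.snd (hrep i)) k
    simp only [h, Option.elim, Prod.snd_add, Prod.smul_mk, Prod.snd_sum, Pi.add_apply,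
      Finset.sum_apply, Pi.smul_apply, smul_eq_mul] at this
    rw [add_comm, ← this, ← Finset.sum_coe_sort B]
  have hr : ∀ i, r i = L.eval i / L.eval i₁ := fun i => by
    have e := L.sum_mul_eval_add B (μ i) (r i) i₁
    rw [h0, Finset.sum_eq_zero fun z hz => by rw [hZL z (hBZ z hz).1]; simp, zero_add] at e
    simp only [h1] at e
    rw [eq_div_iff hLq, e, IntAffine.eval]
    push_cast
    ring
  refine ⟨z₀, hz₀, B, hB, μ, fun i => hr i ▸ h0 i, fun i k => hr i ▸ h1 i k, ?_⟩
  intro z hz hzero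
  have hrz : r z₀ = 0 := by rw [hr, hZL z₀ hz₀]; simp
  -- If `μ z₀ z` vanished, expressing `z₀` through `B` would be an affine dependence inside the
  -- proper subset `Z \ {z}`, with coefficient `-1` at `z₀`.
  have hz₀B : z₀ ∉ B := fun hh => (hBZ _ hh).2 rfl
  have hsplit : ∀ f : (Fin d → ℤ) → ℝ, ∑ x ∈ insert z₀ (B.erase z),
      (if x = z₀ then (-1 : ℝ) else μ z₀ x) * f x = -f z₀ + ∑ x ∈ B, (μ z₀ x : ℝ) * f x := by
    intro f
    rw [Finset.sum_insert (by simp [hz₀B]), ← Finset.add_sum_erase B _ hz, hzero]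
    simp only [if_true, neg_one_mul, Rat.cast_zero, zero_mul, zero_add, add_right_inj]
    refine Finset.sum_congr rfl fun x hx => ?_
    rw [if_neg (hBZ x (Finset.mem_of_mem_erase hx)).2]
  have := weights_eq_zero_of_affineIndependent (T := insert z₀ (B.erase z)) (S := Z \ {z})
    (by
      intro x hx
      rcases Finset.mem_insert.1 hx with rfl | hx
      · exact ⟨hz₀, fun hh => (hBZ z hz).2 hh.symm⟩
      · exact ⟨(hBZ x (Finset.mem_of_mem_erase hx)).1, (Finset.mem_erase.1 hx).1⟩)
    (hZ.2 _ (Set.sdiff_singleton_ssubset.2 (hBZ z hz).1))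
    (fun x => if x = z₀ then (-1 : ℝ) else μ z₀ x)
    (by
      have := hsplit (fun _ => 1)
      simp only [mul_one] at this
      rw [this]
      have := h0 z₀
      rw [hrz, add_zero] at this
      rw [neg_add_eq_zero]
      exact_mod_cast this.symm)
    (fun k => by
      rw [hsplit (fun x => (x k : ℝ))]
      have := h1 z₀ k
      rw [hrz, zero_mul, add_zero] at this
      rw [neg_add_eq_zero]
      exact_mod_cast this.symm)
    z₀ (Finset.mem_insert_self _ _)
  simp at this

end Circuits

/-! ### Singular points in terms of monomial values -/

section Laurent

variable {d : ℕ} {K : Type*} [Field K]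

theorem laurentEval_add (b : Fin d → Kˣ) (F G : AddMonoidAlgebra K (Fin d → ℤ)) :
    laurentEval b (F + G) = laurentEval b F + laurentEval b G := by
  simp only [laurentEval, AddMonoidAlgebra.coeff_add]
  exact Finsupp.sum_add_index' (by simp) (by intros; ring)

theorem laurentEval_sum (b : Fin d → Kˣ) {ι : Type*} (s : Finset ι)
    (G : ι → AddMonoidAlgebra K (Fin d → ℤ)) :
    laurentEval b (∑ x ∈ s, G x) = ∑ x ∈ s, laurentEval b (G x) := by
  classical
  induction s using Finset.induction_on with
  | empty => simp [laurentEval]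
  | insert a s ha ih => rw [Finset.sum_insert ha, Finset.sum_insert ha, laurentEval_add, ih]

theorem laurentEval_single (b : Fin d → Kˣ) (i : Fin d → ℤ) (a : K) :
    laurentEval b (AddMonoidAlgebra.single i a) = a * ((∏ k, b k ^ i k : Kˣ) : K) := by
  simp [laurentEval]

theorem prod_zpow_sub_single (b : Fin d → Kˣ) (i : Fin d → ℤ) (k : Fin d) :
    (∏ l, b l ^ (i - Pi.single k 1 : Fin d → ℤ) l : Kˣ) = (b k)⁻¹ * ∏ l, b l ^ i l := by
  simp only [Pi.sub_apply, zpow_sub, Finset.prod_mul_distrib, Finset.prod_inv_distrib]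
  rw [mul_comm]
  congr 2
  rw [Finset.prod_eq_single k]
  · simp
  · intro l _ hl; simp [hl]
  · simp

/-- Multiplying `∂F/∂x_k` at `b` by the unit `b k` gives the Euler derivative, which weights each
term by `i k`. -/
theorem isSingularZero_iff (F : AddMonoidAlgebra K (Fin d → ℤ)) (b : Fin d → Kˣ) :
    IsSingularZero F b ↔
      ∑ i ∈ F.coeff.support, F.coeff i * ((∏ k, b k ^ i k : Kˣ) : K) = 0 ∧
      ∀ k, ∑ i ∈ F.coeff.support, (i k : K) * (F.coeff i * ((∏ l, b l ^ i l : Kˣ) : K)) = 0 := by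
  refine and_congr Iff.rfl (forall_congr' fun k => ?_)
  have : laurentEval b (laurentDeriv k F) = ((b k)⁻¹ : Kˣ) *
      ∑ i ∈ F.coeff.support, (i k : K) * (F.coeff i * ((∏ l, b l ^ i l : Kˣ) : K)) := by
    rw [laurentDeriv, Finsupp.sum, laurentEval_sum, Finset.mul_sum]
    refine Finset.sum_congr rfl fun i _ => ?_
    rw [laurentEval_single, prod_zpow_sub_single, Units.val_mul]
    ring
  rw [this]
  simp

theorem val_prod_zpow (val : AddValuation K (WithTop ℝ)) (b : Fin d → Kˣ) (q : Fin d → ℝ)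
    (hb : ∀ k, val (b k : K) = ((q k : ℝ) : WithTop ℝ)) (i : Fin d → ℤ) :
    val ((∏ k, b k ^ i k : Kˣ) : K) = ((pair i q : ℝ) : WithTop ℝ) := by
  classical
  have hpow : ∀ k (n : ℕ), val ((b k ^ n : Kˣ) : K) = (((n : ℝ) * q k : ℝ) : WithTop ℝ) := by
    intro k n
    rw [Units.val_pow_eq_pow_val, val.map_pow, hb, ← WithTop.coe_nsmul, nsmul_eq_mul]
  have hz : ∀ k (n : ℤ), val ((b k ^ n : Kˣ) : K) = (((n : ℝ) * q k : ℝ) : WithTop ℝ) := by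
    intro k n
    cases n with
    | ofNat n => simpa using hpow k n
    | negSucc n =>
      rw [zpow_negSucc, Units.val_inv_eq_inv_val, val.map_inv, hpow]
      rw [← WithTop.LinearOrderedAddCommGroup.coe_neg]
      rw [WithTop.coe_inj, Int.cast_negSucc, neg_mul, Nat.cast_succ]
  rw [pair]
  suffices h : ∀ s : Finset (Fin d), val ((∏ k ∈ s, b k ^ i k : Kˣ) : K) =
      ((∑ k ∈ s, (i k : ℝ) * q k : ℝ) : WithTop ℝ) from h _
  intro s
  induction s using Finset.induction_on with
  | empty => simp
  | insert a s ha ih =>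
    rw [Finset.prod_insert ha, Finset.sum_insert ha, Units.val_mul, val.map_mul, ih, hz,
      WithTop.coe_add]

/-- Singular points in terms of the terms `c_i = a_i b^i` of the polynomial. -/
theorem IsTropSingular.exists_terms {val : AddValuation K (WithTop ℝ)}
    {A : Finset (Fin d → ℤ)} {p : (Fin d → ℤ) → ℝ} {q : Fin d → ℝ}
    (h : IsTropSingular val A p q) : ∃ c : (Fin d → ℤ) → K,
      (∀ i ∈ A, val (c i) = ((tropTerm p i q : ℝ) : WithTop ℝ)) ∧
      ∑ i ∈ A, c i = 0 ∧ ∀ k, ∑ i ∈ A, (i k : K) * c i = 0 := by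
  obtain ⟨-, F, b, rfl, hF, hb, hs⟩ := h
  rw [isSingularZero_iff] at hs
  refine ⟨fun i => F.coeff i * ((∏ k, b k ^ i k : Kˣ) : K), fun i hi => ?_, hs.1, hs.2⟩
  rw [val.map_mul, hF i hi, val_prod_zpow val b q hb, tropTerm, WithTop.coe_add]

theorem IsTropSingular.of_terms {val : AddValuation K (WithTop ℝ)}
    {A : Finset (Fin d → ℤ)} {p : (Fin d → ℤ) → ℝ} {q : Fin d → ℝ}
    (hq : q ∈ tropHypersurface A p)
    (hqv : ∀ k, ∃ x : K, val x = ((q k : ℝ) : WithTop ℝ)) (c : (Fin d → ℤ) → K)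
    (hc : ∀ i ∈ A, val (c i) = ((tropTerm p i q : ℝ) : WithTop ℝ))
    (h0 : ∑ i ∈ A, c i = 0) (h1 : ∀ k, ∑ i ∈ A, (i k : K) * c i = 0) :
    IsTropSingular val A p q := by
  classical
  choose x hx using hqv
  have hx0 : ∀ k, x k ≠ 0 := fun k h => by
    have := hx k
    rw [h, val.map_zero] at this
    exact WithTop.top_ne_coe this
  let b : Fin d → Kˣ := fun k => Units.mk0 (x k) (hx0 k)
  have hb : ∀ k, val (b k : K) = ((q k : ℝ) : WithTop ℝ) := fun k => hx k
  let a : (Fin d → ℤ) → K := fun i =>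
    if i ∈ A then c i * (((∏ k, b k ^ i k : Kˣ)⁻¹ : Kˣ) : K) else 0
  have ha : ∀ i ∈ A, a i = c i * (((∏ k, b k ^ i k : Kˣ)⁻¹ : Kˣ) : K) := fun i hi => if_pos hi
  have hva : ∀ i ∈ A, val (a i) = ((p i : ℝ) : WithTop ℝ) := fun i hi => by
    rw [ha i hi, val.map_mul, hc i hi, Units.val_inv_eq_inv_val, val.map_inv,
      val_prod_zpow val b q hb, ← WithTop.LinearOrderedAddCommGroup.coe_neg, ← WithTop.coe_add,
      tropTerm, add_neg_cancel_right]
  have hane : ∀ i, a i ≠ 0 ↔ i ∈ A := fun i => by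
    constructor
    · intro h
      by_contra hi
      exact h (if_neg hi)
    · intro hi h
      have := hva i hi
      rw [h, val.map_zero] at this
      exact WithTop.top_ne_coe this
  let F : AddMonoidAlgebra K (Fin d → ℤ) :=
    AddMonoidAlgebra.ofCoeff ⟨A, a, fun i => (hane i).symm⟩
  have hFa : ∀ i, F.coeff i = a i := fun i => rfl
  have hFs : F.coeff.support = A := rfl
  have hterm : ∀ i ∈ A, a i * ((∏ k, b k ^ i k : Kˣ) : K) = c i := fun i hi => by
    rw [ha i hi, mul_assoc, ← Units.val_mul, inv_mul_cancel, Units.val_one, mul_one]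
  refine ⟨hq, F, b, hFs, hva, hb, ?_⟩
  rw [isSingularZero_iff, hFs]
  simp only [hFa]
  refine ⟨?_, fun k => ?_⟩
  · rw [Finset.sum_congr rfl hterm, h0]
  · rw [← h1 k]
    exact Finset.sum_congr rfl fun i hi => by rw [hterm i hi]

end Laurent

/-! ### Valuations in residue characteristic zero, and the value group -/

section Valuation

variable {K : Type*} [Field K] (val : AddValuation K (WithTop ℝ))

/-- A nonzero `n` stays nonzero in the residue field, so it is a unit of the valuation ring. -/
theorem val_natCast
    [CharZero (IsLocalRing.ResidueField (AddValuation.toValuation val).valuationSubring)]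
    {n : ℕ} (hn : n ≠ 0) : val (n : K) = 0 := by
  have hmem : ∀ x : K, x ∈ (AddValuation.toValuation val).valuationSubring ↔ 0 ≤ val x :=
    fun x => Iff.rfl
  have h : IsLocalRing.residue (AddValuation.toValuation val).valuationSubring
      (n : (AddValuation.toValuation val).valuationSubring) ≠ 0 := by
    rw [map_natCast]; exact_mod_cast hn
  rw [IsLocalRing.residue_ne_zero_iff_isUnit] at h
  obtain ⟨y, hy⟩ := h.exists_right_inv
  have hxy : (n : K) * (y : K) = 1 := by
    have := congrArg Subtype.val hy
    simpa using this
  have h1 : 0 ≤ val (n : K) := (hmem _).1 (natCast_mem _ n)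
  have h2 : 0 ≤ val (y : K) := (hmem _).1 y.2
  refine le_antisymm ?_ h1
  calc val (n : K) ≤ val (n : K) + val (y : K) := le_add_of_nonneg_right h2
    _ = 0 := by rw [← val.map_mul, hxy, val.map_one]

theorem val_intCast
    [CharZero (IsLocalRing.ResidueField (AddValuation.toValuation val).valuationSubring)]
    {n : ℤ} (hn : n ≠ 0) : val (n : K) = 0 := by
  rcases Int.natAbs_eq n with h | h
  · rw [h, Int.cast_natCast]; exact val_natCast val (by omega)
  · rw [h, Int.cast_neg, Int.cast_natCast, val.map_neg]; exact val_natCast val (by omega)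

variable [CharZero (IsLocalRing.ResidueField (AddValuation.toValuation val).valuationSubring)]

theorem val_ratCast {r : ℚ} (hr : r ≠ 0) : val (r : K) = 0 := by
  rw [Rat.cast_def, div_eq_mul_inv, val.map_mul, val.map_inv, val_natCast val r.den_nz,
    val_intCast val (Rat.num_ne_zero.2 hr)]
  simp

theorem val_ratCast_nonneg (r : ℚ) : 0 ≤ val (r : K) := by
  by_cases hr : r = 0
  · simp [hr]
  · rw [val_ratCast val hr]

theorem le_val_ratCast_mul {g : WithTop ℝ} (r : ℚ) {x : K} (hx : g ≤ val x) :
    g ≤ val ((r : K) * x) := by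
  rw [val.map_mul]
  exact le_add_of_nonneg_of_le (val_ratCast_nonneg val r) hx

/-- Finitely many affine forms with coefficients of valuation zero take values without
cancellation at a suitable point of prescribed valuation. -/
theorem exists_val_eq_of_generic {ι : Type*} (J : Finset ι) (α T : ι → K) {s : WithTop ℝ}
    (hα : ∀ j ∈ J, val (α j) = 0) (hT : ∀ j ∈ J, s ≤ val (T j))
    (hu : ∃ u : K, val u = s) :
    ∃ x : K, val x = s ∧ ∀ j ∈ J, val (α j * x + T j) = s := by
  obtain ⟨u, hu⟩ := hu
  -- All candidates `(n + 1) u` have valuation `s`. For each `j` at most one `n` causes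
  -- cancellation: two such values would differ by `α j * (n - m) * u`, whose valuation is exactly
  -- `s`.
  let bad : ι → Set ℕ := fun j => {n | s < val (α j * (((n + 1 : ℕ) : K) * u) + T j)}
  have hval : ∀ n : ℕ, val (((n + 1 : ℕ) : K) * u) = s := fun n => by
    rw [val.map_mul, val_natCast val n.succ_ne_zero, hu, zero_add]
  have hfin : (⋃ j ∈ J, bad j).Finite := by
    refine J.finite_toSet.biUnion fun j hj => Set.Subsingleton.finite fun n hn m hm => ?_
    by_contra hne
    have hd : val (α j * (((n : ℤ) - m : ℤ) * u)) = s := by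
      rw [val.map_mul, val.map_mul, hα j hj,
        val_intCast val (sub_ne_zero.2 (by exact_mod_cast hne)), hu, zero_add, zero_add]
    have hlt : s < val ((α j * (((n + 1 : ℕ) : K) * u) + T j) -
        (α j * (((m + 1 : ℕ) : K) * u) + T j)) :=
      lt_of_lt_of_le (lt_min hn hm) (val.map_sub _ _)
    refine hlt.ne' ?_
    rw [← hd]
    congr 1
    push_cast
    ring
  obtain ⟨n, hn⟩ := hfin.exists_notMem
  refine ⟨((n + 1 : ℕ) : K) * u, hval n, fun j hj => ?_⟩
  have hnb : ¬ s < val (α j * (((n + 1 : ℕ) : K) * u) + T j) := fun h =>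
    hn (Set.mem_biUnion hj h)
  refine le_antisymm (not_lt.1 hnb) ?_
  refine le_trans (le_min ?_ (hT j hj)) (val.map_add _ _)
  rw [val.map_mul, hα j hj, zero_add, hval]

end Valuation

/-- The finite values of a valuation on an algebraically closed field form a rational
vector space. -/
def valueSpace {K : Type*} [Field K] [IsAlgClosed K] (val : AddValuation K (WithTop ℝ)) :
    Submodule ℚ ℝ where
  carrier := {r | ∃ x : K, val x = ((r : ℝ) : WithTop ℝ)}
  add_mem' := by
    rintro a b ⟨x, hx⟩ ⟨y, hy⟩
    exact ⟨x * y, by rw [val.map_mul, hx, hy, WithTop.coe_add]⟩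
  zero_mem' := ⟨1, by simp⟩
  smul_mem' := by
    rintro r a ⟨x, hx⟩
    obtain ⟨y, hy⟩ := IsAlgClosed.exists_pow_nat_eq x r.den_pos
    have hy0 : y ≠ 0 := by
      rintro rfl
      rw [zero_pow r.den_nz] at hy
      rw [← hy, val.map_zero] at hx
      exact WithTop.top_ne_coe hx
    obtain ⟨b, hb⟩ := WithTop.ne_top_iff_exists.1 ((val.ne_top_iff).2 hy0)
    have hab : a = r.den * b := by
      rw [← hy, val.map_pow, ← hb, ← WithTop.coe_nsmul, nsmul_eq_mul] at hx
      exact (WithTop.coe_inj.1 hx).symm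
    have hpos : ∀ n : ℕ, val (y ^ n) = (((n : ℝ) * b : ℝ) : WithTop ℝ) := fun n => by
      rw [val.map_pow, ← hb, ← WithTop.coe_nsmul, nsmul_eq_mul]
    have hr : r • a = (r.num : ℝ) * b := by
      rw [hab, Rat.smul_def, ← mul_assoc, ← Rat.cast_natCast, ← Rat.cast_mul,
        Rat.mul_den_eq_num, Rat.cast_intCast]
    rw [Set.mem_ofPred_eq, hr]
    rcases Int.natAbs_eq r.num with h | h
    · exact ⟨y ^ r.num.natAbs, by rw [hpos, h]; simp⟩
    · refine ⟨(y ^ r.num.natAbs)⁻¹, ?_⟩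
      rw [val.map_inv, hpos, ← WithTop.LinearOrderedAddCommGroup.coe_neg, WithTop.coe_inj]
      rw [h]; simp

/-! ### Solving the linear system for the terms -/

theorem sum_eq_zero_of_coordinates {ι K : Type*} [DecidableEq ι] [Field K]
    {A R B : Finset ι} {i₁ : ι} (hA : A = insert i₁ (B ∪ R)) (hB : i₁ ∉ B) (hR : i₁ ∉ R)
    (hBR : Disjoint B R) (μ : ι → ι → K) (r : ι → K) (c g : ι → K)
    (hg : ∀ i ∈ R, ∑ z ∈ B, μ i z * g z + r i * g i₁ = g i)
    (hcB : ∀ z ∈ B, c z = -∑ i ∈ R, μ i z * c i) (hc : c i₁ = -∑ i ∈ R, r i * c i) :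
    ∑ i ∈ A, g i * c i = 0 := by
  have e1 : ∑ z ∈ B, g z * c z = -∑ i ∈ R, (∑ z ∈ B, μ i z * g z) * c i := by
    rw [Finset.sum_congr rfl fun z hz => congrArg (g z * ·) (hcB z hz)]
    simp only [mul_neg, Finset.sum_neg_distrib, Finset.mul_sum, Finset.sum_mul]
    rw [Finset.sum_comm]
    exact congrArg _ (Finset.sum_congr rfl fun _ _ => Finset.sum_congr rfl fun _ _ => by ring)
  have e2 : ∑ i ∈ R, g i * c i =
      ∑ i ∈ R, (∑ z ∈ B, μ i z * g z) * c i + ∑ i ∈ R, g i₁ * (r i * c i) := by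
    rw [← Finset.sum_add_distrib]
    exact Finset.sum_congr rfl fun i hi => by rw [← hg i hi]; ring
  rw [hA, Finset.sum_insert (by simp [hB, hR]), Finset.sum_union hBR, e1, e2, hc,
    ← Finset.mul_sum]
  ring

/-- Solving the linear system for the terms of a polynomial singular at `(1, …, 1)` with
prescribed valuations. -/
theorem exists_balanced_terms {d : ℕ} {K : Type*} [Field K] [CharZero K]
    (val : AddValuation K (WithTop ℝ))
    [CharZero (IsLocalRing.ResidueField (AddValuation.toValuation val).valuationSubring)]
    {A B : Finset (Fin d → ℤ)} {z₀ i₁ i₂ : Fin d → ℤ} (hBA : B ⊆ A) (hz₀ : z₀ ∈ A)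
    (hi₁ : i₁ ∈ A) (hi₂ : i₂ ∈ A) (hz₀B : z₀ ∉ B) (hi₁B : i₁ ∉ B) (hi₂B : i₂ ∉ B)
    (h01 : z₀ ≠ i₁) (h02 : z₀ ≠ i₂) (h12 : i₁ ≠ i₂)
    (μ : (Fin d → ℤ) → (Fin d → ℤ) → ℚ) (r : (Fin d → ℤ) → ℚ)
    (h0 : ∀ i, ∑ z ∈ B, μ i z + r i = 1)
    (h1 : ∀ i k, ∑ z ∈ B, μ i z * (z k : ℚ) + r i * i₁ k = i k)
    (hμ : ∀ z ∈ B, μ z₀ z ≠ 0) (hr₀ : r z₀ = 0) (hr₂ : r i₂ ≠ 0)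
    (P : (Fin d → ℤ) → ℝ) (hP : ∀ i ∈ A, ∃ x : K, val x = ((P i : ℝ) : WithTop ℝ))
    {m s : ℝ} (hPB : ∀ z ∈ B, P z = m) (hPz : P z₀ = m) (hPm : ∀ i ∈ A, m ≤ P i)
    (hP₁ : P i₁ = s) (hP₂ : P i₂ = s) (hPs : ∀ i ∈ A, r i ≠ 0 → s ≤ P i) :
    ∃ c : (Fin d → ℤ) → K, (∀ i ∈ A, val (c i) = ((P i : ℝ) : WithTop ℝ)) ∧
      ∑ i ∈ A, c i = 0 ∧ ∀ k, ∑ i ∈ A, (i k : K) * c i = 0 := by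
  classical
  have hP' : ∀ i, ∃ x : K, i ∈ A → val x = ((P i : ℝ) : WithTop ℝ) := fun i => by
    by_cases hi : i ∈ A
    · obtain ⟨x, hx⟩ := hP i hi; exact ⟨x, fun _ => hx⟩
    · exact ⟨0, fun h => absurd h hi⟩
  choose γ hγ using hP'
  set R := (A \ B).erase i₁ with hR
  set R' := (R.erase z₀).erase i₂ with hR'
  have hz₀R : z₀ ∈ R := by simp [hR, hz₀, hz₀B, h01]
  have hi₂R : i₂ ∈ R.erase z₀ := by simp [hR, hi₂, hi₂B, h12.symm, h02.symm]
  have hRA : ∀ i ∈ R, i ∈ A := fun i hi => by simp [hR] at hi; exact hi.2.1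
  have hR'A : ∀ i ∈ R', i ∈ A := fun i hi =>
    hRA i (Finset.mem_of_mem_erase (Finset.mem_of_mem_erase hi))
  -- The term at `i₂` is chosen so that the solved term at `i₁` has valuation exactly `s`.
  obtain ⟨x₂, hx₂, hx₂'⟩ := exists_val_eq_of_generic val (Finset.univ : Finset Unit)
    (fun _ => (r i₂ : K)) (fun _ => ∑ i ∈ R', (r i : K) * γ i) (s := (s : WithTop ℝ))
    (fun _ _ => val_ratCast val hr₂)
    (fun _ _ => val.map_le_sum fun i hi => by
      by_cases hri : r i = 0
      · simp [hri]
      · refine le_val_ratCast_mul val _ ?_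
        rw [hγ i (hR'A i hi)]
        exact WithTop.coe_le_coe.2 (hPs i (hR'A i hi) hri))
    ⟨γ i₂, by rw [hγ i₂ hi₂, hP₂]⟩
  have hx₂'' := hx₂' () (Finset.mem_univ _)
  -- The term at `z₀` is chosen so that all solved terms on `B` have valuation exactly `m` at once.
  -- As `r z₀ = 0`, this leaves the term at `i₁` untouched.
  obtain ⟨x₀, hx₀, hx₀'⟩ := exists_val_eq_of_generic val B
    (fun z => (μ z₀ z : K)) (fun z => (μ i₂ z : K) * x₂ + ∑ i ∈ R', (μ i z : K) * γ i)
    (s := (m : WithTop ℝ)) (fun z hz => val_ratCast val (hμ z hz))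
    (fun z _ => le_trans (le_min
      (le_val_ratCast_mul val _ (by
        rw [hx₂]; exact WithTop.coe_le_coe.2 (hP₂ ▸ hPm i₂ hi₂)))
      (val.map_le_sum fun i hi => le_val_ratCast_mul val _ (by
        rw [hγ i (hR'A i hi)]; exact WithTop.coe_le_coe.2 (hPm i (hR'A i hi)))))
      (val.map_add _ _))
    ⟨γ z₀, by rw [hγ z₀ hz₀, hPz]⟩
  let c₀ : (Fin d → ℤ) → K := fun i => if i = z₀ then x₀ else if i = i₂ then x₂ else γ i
  have hc₀z : c₀ z₀ = x₀ := if_pos rfl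
  have hc₀i : c₀ i₂ = x₂ := by simp [c₀, h02.symm]
  have hc₀R : ∀ i ∈ R', c₀ i = γ i := fun i hi => by
    simp only [hR', Finset.mem_erase] at hi
    simp [c₀, hi.1, hi.2.1]
  have hsplit : ∀ f : (Fin d → ℤ) → K, ∑ i ∈ R, f i * c₀ i =
      f z₀ * x₀ + (f i₂ * x₂ + ∑ i ∈ R', f i * γ i) := fun f => by
    rw [← Finset.add_sum_erase R _ hz₀R, ← Finset.add_sum_erase _ _ hi₂R, hc₀z, hc₀i,
      Finset.sum_congr rfl fun i hi => by rw [hc₀R i hi]]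
  let c : (Fin d → ℤ) → K := fun i =>
    if i = i₁ then -∑ j ∈ R, (r j : K) * c₀ j
    else if i ∈ B then -∑ j ∈ R, (μ j i : K) * c₀ j else c₀ i
  have hcR : ∀ i ∈ R, c i = c₀ i := fun i hi => by
    simp only [hR, Finset.mem_erase, Finset.mem_sdiff] at hi
    simp [c, hi.1, hi.2.2]
  have hc1 : c i₁ = -∑ j ∈ R, (r j : K) * c₀ j := if_pos rfl
  have hcB : ∀ z ∈ B, c z = -∑ j ∈ R, (μ j z : K) * c₀ j := fun z hz => by
    have : z ≠ i₁ := fun h => hi₁B (h ▸ hz)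
    simp [c, this, hz]
  have hAeq : A = insert i₁ (B ∪ R) := by
    ext i
    simp only [hR, Finset.mem_insert, Finset.mem_union, Finset.mem_erase, Finset.mem_sdiff]
    constructor
    · intro hi; tauto
    · rintro (rfl | h | h)
      · exact hi₁
      · exact hBA h
      · exact h.2.1
  have hbal : ∀ g : (Fin d → ℤ) → K,
      (∀ i ∈ R, ∑ z ∈ B, (μ i z : K) * g z + (r i : K) * g i₁ = g i) →
      ∑ i ∈ A, g i * c i = 0 := fun g hg => by
    refine sum_eq_zero_of_coordinates hAeq hi₁B (by simp [hR]) ?_ (fun i z => (μ i z : K))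
      (fun i => (r i : K)) c g hg ?_ ?_
    · rw [Finset.disjoint_left]
      intro z hz hzR
      simp [hR, hz] at hzR
    · intro z hz
      rw [hcB z hz, Finset.sum_congr rfl fun i hi => congrArg ((μ i z : K) * ·) (hcR i hi)]
    · rw [hc1, Finset.sum_congr rfl fun i hi => congrArg ((r i : K) * ·) (hcR i hi)]
  refine ⟨c, fun i hi => ?_, ?_, fun k => ?_⟩
  · by_cases h1 : i = i₁
    · rw [h1, hc1, val.map_neg, hsplit, hr₀, Rat.cast_zero, zero_mul, zero_add, hx₂'', hP₁]
    by_cases hB : i ∈ B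
    · rw [hcB i hB, val.map_neg, hsplit, hx₀' i hB, hPB i hB]
    have hiR : i ∈ R := by simp [hR, hi, h1, hB]
    rw [hcR i hiR]
    by_cases hz : i = z₀
    · rw [hz, hc₀z, hx₀, hPz]
    by_cases h2 : i = i₂
    · rw [h2, hc₀i, hx₂, hP₂]
    rw [hc₀R i (by simp [hR', hz, h2, hiR]), hγ i hi]
  · have := hbal (fun _ => 1) (fun i _ => by
      simp only [mul_one]
      exact_mod_cast congrArg (Rat.cast (K := K)) (h0 i))
    simpa using this
  · exact hbal (fun i => (i k : K)) (fun i _ => by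
      exact_mod_cast congrArg (Rat.cast (K := K)) (h1 i k))

/-! ### Dual cells, pyramids and supporting hyperplanes -/

section Geometry

variable {d : ℕ}

theorem mem_minSupport_iff {A : Finset (Fin d → ℤ)} {p : (Fin d → ℤ) → ℝ} {w : Fin d → ℝ}
    {i : Fin d → ℤ} : i ∈ minSupport A p w ↔
      i ∈ A ∧ ∀ j ∈ A, tropTerm p i w ≤ tropTerm p j w := by
  refine and_congr_right fun hi => ?_
  have hle : tropEval A p w ≤ ((tropTerm p i w : ℝ) : WithTop ℝ) := Finset.inf_le hi
  have h : ((tropTerm p i w : ℝ) : WithTop ℝ) ≤ tropEval A p w ↔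
      ∀ j ∈ A, tropTerm p i w ≤ tropTerm p j w := by
    simp only [tropEval, Finset.le_inf_iff, WithTop.coe_le_coe]
  exact ⟨fun e => h.1 e.ge, fun e => le_antisymm hle (h.2 e)⟩

theorem pair_sub_right (i : Fin d → ℤ) (u w : Fin d → ℝ) :
    pair i (u - w) = pair i u - pair i w := by
  simp only [pair, Pi.sub_apply, mul_sub, Finset.sum_sub_distrib]

theorem pair_sub_left (i j : Fin d → ℤ) (w : Fin d → ℝ) :
    pair (i - j) w = pair i w - pair j w := by
  simp only [pair, Pi.sub_apply, Int.cast_sub, sub_mul, Finset.sum_sub_distrib]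

theorem pair_zero_left (w : Fin d → ℝ) : pair 0 w = 0 := by simp [pair]

theorem pair_single (k : Fin d) (w : Fin d → ℝ) : pair (Pi.single k 1) w = w k := by
  rw [pair, Finset.sum_eq_single k]
  · simp
  · intro l _ hl; simp [hl]
  · simp

theorem continuous_tropTerm (p : (Fin d → ℤ) → ℝ) (i : Fin d → ℤ) :
    Continuous (tropTerm p i) := by
  unfold tropTerm pair
  fun_prop

theorem tropTerm_eq_of_mem_dualCell {A : Finset (Fin d → ℤ)} {p : (Fin d → ℤ) → ℝ}
    {σ : Set (Fin d → ℤ)} {q : Fin d → ℝ} (hq : q ∈ dualCell A p σ) {i j : Fin d → ℤ}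
    (hi : i ∈ σ) (hj : j ∈ σ) : tropTerm p i q = tropTerm p j q := by
  have hcl : IsClosed {w | tropTerm p i w = tropTerm p j w} :=
    isClosed_eq (continuous_tropTerm p i) (continuous_tropTerm p j)
  refine closure_minimal ?_ hcl hq
  rintro w ⟨-, rfl⟩
  rw [mem_minSupport_iff] at hi hj
  exact le_antisymm (hi.2 j hj.1) (hj.2 i hi.1)

theorem pair_eq_combination {B : Finset (Fin d → ℤ)} {i₁ : Fin d → ℤ}
    {μ : (Fin d → ℤ) → (Fin d → ℤ) → ℚ} {r : (Fin d → ℤ) → ℚ}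
    (h1 : ∀ i k, ∑ z ∈ B, μ i z * (z k : ℚ) + r i * i₁ k = i k) (i : Fin d → ℤ)
    (w : Fin d → ℝ) :
    pair i w = ∑ z ∈ B, (μ i z : ℝ) * pair z w + (r i : ℝ) * pair i₁ w := by
  have h1' : ∀ k, (i k : ℝ) = ∑ z ∈ B, (μ i z : ℝ) * (z k : ℝ) + (r i : ℝ) * i₁ k := fun k => by
    exact_mod_cast (congrArg (Rat.cast (K := ℝ)) (h1 i k)).symm
  simp only [pair, h1', add_mul, Finset.sum_mul, Finset.sum_add_distrib, Finset.mul_sum]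
  rw [Finset.sum_comm]
  simp only [mul_assoc]

theorem pair_eq_of_eq_on {B : Finset (Fin d → ℤ)} {i₁ : Fin d → ℤ}
    {μ : (Fin d → ℤ) → (Fin d → ℤ) → ℚ} {r : (Fin d → ℤ) → ℚ}
    (h0 : ∀ i, ∑ z ∈ B, μ i z + r i = 1)
    (h1 : ∀ i k, ∑ z ∈ B, μ i z * (z k : ℚ) + r i * i₁ k = i k) {u : Fin d → ℝ} {e : ℝ}
    (hB : ∀ z ∈ B, pair z u = e) (i : Fin d → ℤ) :
    pair i u = e + r i * (pair i₁ u - e) := by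
  have h0' : ∑ z ∈ B, (μ i z : ℝ) = 1 - r i := by
    rw [eq_sub_iff_add_eq]
    exact_mod_cast congrArg (Rat.cast (K := ℝ)) (h0 i)
  rw [pair_eq_combination h1, Finset.sum_congr rfl fun z hz => congrArg (_ * ·) (hB z hz),
    ← Finset.sum_mul, h0']
  ring

/-- The difference of two points of the cell pairs equally with a whole affine basis, hence with
every lattice point; comparing `0` with the unit vectors shows that it vanishes. -/
theorem eq_of_mem_dualCell {A B : Finset (Fin d → ℤ)} {i₁ : Fin d → ℤ}
    {μ : (Fin d → ℤ) → (Fin d → ℤ) → ℚ} {r : (Fin d → ℤ) → ℚ}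
    (h0 : ∀ i, ∑ z ∈ B, μ i z + r i = 1)
    (h1 : ∀ i k, ∑ z ∈ B, μ i z * (z k : ℚ) + r i * i₁ k = i k)
    {p : (Fin d → ℤ) → ℝ} {σ : Set (Fin d → ℤ)} (hB : ∀ z ∈ B, z ∈ σ) (hi₁ : i₁ ∈ σ)
    {v w : Fin d → ℝ} (hv : v ∈ dualCell A p σ) (hw : w ∈ dualCell A p σ) : v = w := by
  have hpair : ∀ z ∈ B, pair z (v - w) = pair i₁ (v - w) := fun z hz => by
    have e1 := tropTerm_eq_of_mem_dualCell hv (hB z hz) hi₁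
    have e2 := tropTerm_eq_of_mem_dualCell hw (hB z hz) hi₁
    simp only [tropTerm] at e1 e2
    rw [pair_sub_right, pair_sub_right]
    linarith
  have hall := pair_eq_of_eq_on h0 h1 hpair
  simp only [sub_self, mul_zero, add_zero] at hall
  have hz := hall 0
  rw [pair_zero_left] at hz
  ext k
  have := hall (Pi.single k 1)
  rw [pair_single, ← hz, Pi.sub_apply] at this
  linarith

theorem minSupport_eq_of_mem_dualCell {A B : Finset (Fin d → ℤ)} {i₁ : Fin d → ℤ}
    {μ : (Fin d → ℤ) → (Fin d → ℤ) → ℚ} {r : (Fin d → ℤ) → ℚ}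
    (h0 : ∀ i, ∑ z ∈ B, μ i z + r i = 1)
    (h1 : ∀ i k, ∑ z ∈ B, μ i z * (z k : ℚ) + r i * i₁ k = i k)
    {p : (Fin d → ℤ) → ℝ} {σ : Set (Fin d → ℤ)} (hB : ∀ z ∈ B, z ∈ σ) (hi₁ : i₁ ∈ σ)
    {v : Fin d → ℝ} (hv : v ∈ dualCell A p σ) : minSupport A p v = σ := by
  obtain ⟨w, hw⟩ := closure_nonempty_iff.1 ⟨v, hv⟩
  rw [eq_of_mem_dualCell h0 h1 hB hi₁ hv (subset_closure hw), hw.2]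

theorem mem_submodule_of_tropTerm_eq {B : Finset (Fin d → ℤ)} {i₁ : Fin d → ℤ}
    {μ : (Fin d → ℤ) → (Fin d → ℤ) → ℚ} {r : (Fin d → ℤ) → ℚ}
    (h0 : ∀ i, ∑ z ∈ B, μ i z + r i = 1)
    (h1 : ∀ i k, ∑ z ∈ B, μ i z * (z k : ℚ) + r i * i₁ k = i k)
    {p : (Fin d → ℤ) → ℝ} {v : Fin d → ℝ} {m : ℝ} (hB : ∀ z ∈ B, tropTerm p z v = m)
    (hi₁ : tropTerm p i₁ v = m) (Γ : Submodule ℚ ℝ) (hpB : ∀ z ∈ B, p z ∈ Γ) (hp₁ : p i₁ ∈ Γ) :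
    ∀ k, v k ∈ Γ := by
  -- On the affine basis `m - pair i v` equals `p i`; elsewhere it is the rational affine
  -- combination of these values.
  have key : ∀ i, m - pair i v ∈ Γ := fun i => by
    have h0' : ∑ z ∈ B, (μ i z : ℝ) + r i = 1 := by
      exact_mod_cast congrArg (Rat.cast (K := ℝ)) (h0 i)
    have : m - pair i v = ∑ z ∈ B, μ i z • p z + r i • p i₁ := by
      have hz : ∀ z ∈ B, (μ i z : ℝ) * pair z v = μ i z * m - μ i z • p z := fun z hz => by
        rw [← hB z hz, tropTerm, Rat.smul_def]; ring
      rw [pair_eq_combination h1, Finset.sum_congr rfl hz, Finset.sum_sub_distrib,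
        ← Finset.sum_mul, eq_sub_of_add_eq h0', Rat.smul_def, ← hi₁, tropTerm]
      ring
    rw [this]
    exact Γ.add_mem (Γ.sum_mem fun z hz => Γ.smul_mem _ (hpB z hz)) (Γ.smul_mem _ hp₁)
  intro k
  have := Γ.sub_mem (key 0) (key (Pi.single k 1))
  rw [pair_zero_left, pair_single] at this
  simpa using this

theorem toReal_mem_affineSpan {T : Finset (Fin d → ℤ)} {S : Set (Fin d → ℤ)}
    (hTS : ∀ z ∈ T, z ∈ S) {y : Fin d → ℤ} (w : (Fin d → ℤ) → ℝ) (h0 : ∑ z ∈ T, w z = 1)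
    (h1 : ∀ k, ∑ z ∈ T, w z * (z k : ℝ) = y k) :
    toReal y ∈ affineSpan ℝ (toReal '' S) := by
  have hy : toReal y = T.affineCombination ℝ toReal w := by
    rw [Finset.affineCombination_eq_linear_combination _ _ _ h0]
    ext k
    simpa [toReal] using (h1 k).symm
  rw [hy]
  exact affineSpan_mono ℝ (Set.image_mono fun z hz => hTS z hz)
    (affineCombination_mem_affineSpan_image h0 (s' := (T : Set (Fin d → ℤ)))
      (fun i hi hi' => absurd hi hi') toReal)

/-- If the coordinate of `x` at `i₁` were nonzero, the expansion of `x` could be solved for `i₁`,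
putting the apex in the span of the other points. -/
theorem IsPyramidOver.coordinate_eq_zero {σ : Set (Fin d → ℤ)} {B : Finset (Fin d → ℤ)}
    {i₁ : Fin d → ℤ} (hpyr : IsPyramidOver σ i₁)
    {μ : (Fin d → ℤ) → (Fin d → ℤ) → ℚ} {r : (Fin d → ℤ) → ℚ}
    (h0 : ∀ i, ∑ z ∈ B, μ i z + r i = 1)
    (h1 : ∀ i k, ∑ z ∈ B, μ i z * (z k : ℚ) + r i * i₁ k = i k)
    (hB : ∀ z ∈ B, z ∈ σ ∧ z ≠ i₁ ∧ r z = 0) {x : Fin d → ℤ} (hx : x ∈ σ) (hne : x ≠ i₁) :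
    r x = 0 := by
  classical
  by_contra hr
  have hr' : (r x : ℝ) ≠ 0 := by exact_mod_cast hr
  apply hpyr.2
  have hxB : x ∉ B := fun h => hr (hB x h).2.2
  have hsum : ∀ f : (Fin d → ℤ) → ℝ, ∑ z ∈ insert x B,
      (if z = x then 1 / (r x : ℝ) else -(μ x z : ℝ) / r x) * f z =
      (f x - ∑ z ∈ B, (μ x z : ℝ) * f z) / r x := fun f => by
    have hterm : ∀ z ∈ B, (if z = x then 1 / (r x : ℝ) else -(μ x z : ℝ) / r x) * f z =
        -((μ x z : ℝ) * f z / r x) := fun z hz => by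
      have hzx : z ≠ x := fun h => hxB (h ▸ hz)
      rw [if_neg hzx, neg_div, neg_mul, div_mul_eq_mul_div]
    rw [Finset.sum_insert hxB, if_pos rfl, Finset.sum_congr rfl hterm, Finset.sum_neg_distrib, ← Finset.sum_div]
    ring
  refine toReal_mem_affineSpan (T := insert x B) ?_
    (fun z => if z = x then 1 / (r x : ℝ) else -(μ x z : ℝ) / r x) ?_ fun k => ?_
  · intro z hz
    rcases Finset.mem_insert.1 hz with rfl | hz
    · exact ⟨hx, hne⟩
    · exact ⟨(hB z hz).1, (hB z hz).2.1⟩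
  · have := hsum fun _ => 1
    simp only [mul_one] at this
    rw [this, div_eq_one_iff_eq hr', sub_eq_iff_eq_add, add_comm]
    exact_mod_cast (congrArg (Rat.cast (K := ℝ)) (h0 x)).symm
  · rw [hsum fun z => (z k : ℝ), div_eq_iff hr', sub_eq_iff_eq_add, add_comm, mul_comm (i₁ k : ℝ)]
    exact_mod_cast (congrArg (Rat.cast (K := ℝ)) (h1 x k)).symm

theorem exists_eval_neg_of_mem_interior {A : Set (Fin d → ℤ)} {Z : Set (Fin d → ℤ)}
    {L : IntAffine d} (hZ : ∀ z ∈ Z, L.eval z = 0) (hL : L.lin ≠ 0)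
    (h : (interior (convexHull ℝ (toReal '' A)) ∩ convexHull ℝ (toReal '' Z)).Nonempty) :
    ∃ i ∈ A, L.eval i < 0 := by
  obtain ⟨x, hxA, hxZ⟩ := h
  let ℓ : (Fin d → ℝ) →ₗ[ℝ] ℝ := ∑ k, (L.lin k : ℝ) • LinearMap.proj k
  have hℓ : ∀ y, ℓ y = ∑ k, (L.lin k : ℝ) * y k := fun y => by simp [ℓ]
  have hev : ∀ i : Fin d → ℤ, (L.eval i : ℝ) = ℓ (toReal i) + L.const := fun i => by
    simp [hℓ, IntAffine.eval, toReal]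
  have hx : 0 ≤ -L.const - ℓ x := by
    have hsub : convexHull ℝ (toReal '' Z) ⊆ {y | ℓ y ≤ -L.const} := by
      refine convexHull_min ?_ (convex_halfSpace_le ℓ.isLinear _)
      rintro _ ⟨z, hz, rfl⟩
      have := hev z
      rw [hZ z hz, Int.cast_zero] at this
      change ℓ (toReal z) ≤ -L.const
      linarith
    have : ℓ x ≤ -L.const := hsub hxZ
    linarith
  by_contra hneg
  push Not at hneg
  have hsub : convexHull ℝ (toReal '' A) ⊆ {y | -(L.const : ℝ) ≤ ℓ y} := by
    refine convexHull_min ?_ (convex_halfSpace_ge ℓ.isLinear _)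
    rintro _ ⟨i, hi, rfl⟩
    have h1 := hev i
    have h2 : (0 : ℝ) ≤ L.eval i := by exact_mod_cast hneg i hi
    change -(L.const : ℝ) ≤ ℓ (toReal i)
    linarith
  -- A small step against the gradient of `L` stays in the hull of `A` but makes `L` negative.
  have hcont : Filter.Tendsto (fun ε : ℝ => x - ε • toReal L.lin) (nhdsWithin 0 (Set.Ioi 0))
      (nhds x) := by
    have : Continuous fun ε : ℝ => x - ε • toReal L.lin := by fun_prop
    have := this.tendsto 0
    simp only [zero_smul, sub_zero] at this
    exact this.mono_left nhdsWithin_le_nhds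
  obtain ⟨ε, hε, hpos⟩ := ((hcont.eventually (mem_interior_iff_mem_nhds.1 hxA)).and
    self_mem_nhdsWithin).exists
  have h1 : -(L.const : ℝ) ≤ ℓ (x - ε • toReal L.lin) := hsub hε
  rw [map_sub, map_smul, smul_eq_mul] at h1
  have h2 : 0 < ℓ (toReal L.lin) := by
    rw [hℓ]
    obtain ⟨k, hk⟩ := Function.ne_iff.1 hL
    have hk' : (L.lin k : ℝ) ≠ 0 := by exact_mod_cast hk
    exact Finset.sum_pos' (fun l _ => mul_self_nonneg _)
      ⟨k, Finset.mem_univ _, mul_self_pos.2 hk'⟩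
  have h3 : 0 < ε * ℓ (toReal L.lin) := mul_pos hpos h2
  linarith

end Geometry

/-! ### The two directions of the equivalence -/

section Singular

variable {K : Type*} [Field K] (val : AddValuation K (WithTop ℝ))
  [CharZero (IsLocalRing.ResidueField (AddValuation.toValuation val).valuationSubring)]
  {d : ℕ}

/-- Along an integral affine function `L` the terms of a singular polynomial cannot have a
unique minimum off `{L = 0}`. -/
theorem exists_tropTerm_le_of_balanced {A : Finset (Fin d → ℤ)} {P : (Fin d → ℤ) → ℝ}
    {c : (Fin d → ℤ) → K} (hc : ∀ i ∈ A, val (c i) = ((P i : ℝ) : WithTop ℝ))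
    (h0 : ∑ i ∈ A, c i = 0) (h1 : ∀ k, ∑ i ∈ A, (i k : K) * c i = 0) (L : IntAffine d)
    {i₁ : Fin d → ℤ} (hi₁ : i₁ ∈ A) (hL : L.eval i₁ ≠ 0) :
    ∃ i₂ ∈ A, i₂ ≠ i₁ ∧ L.eval i₂ ≠ 0 ∧ P i₂ ≤ P i₁ := by
  classical
  by_contra hno
  push Not at hno
  have hsum : ∑ i ∈ A, (L.eval i : K) * c i = 0 := by
    simp only [IntAffine.eval, Int.cast_add, Int.cast_sum, Int.cast_mul, add_mul,
      Finset.sum_add_distrib, Finset.sum_mul, ← Finset.mul_sum, h0, mul_zero, add_zero]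
    rw [Finset.sum_comm]
    refine Finset.sum_eq_zero fun k _ => ?_
    simp only [mul_assoc]
    rw [← Finset.mul_sum, h1, mul_zero]
  rw [← Finset.add_sum_erase A _ hi₁] at hsum
  have hv1 : val ((L.eval i₁ : K) * c i₁) = ((P i₁ : ℝ) : WithTop ℝ) := by
    rw [val.map_mul, val_intCast val hL, zero_add, hc i₁ hi₁]
  have hlt : ((P i₁ : ℝ) : WithTop ℝ) < val (∑ i ∈ A.erase i₁, (L.eval i : K) * c i) := by
    refine val.map_lt_sum WithTop.coe_ne_top fun i hi => ?_
    obtain ⟨hne, hiA⟩ := Finset.mem_erase.1 hi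
    by_cases hLi : L.eval i = 0
    · rw [hLi, Int.cast_zero, zero_mul, val.map_zero]
      exact WithTop.coe_lt_top _
    · rw [val.map_mul, val_intCast val hLi, zero_add, hc i hiA]
      exact WithTop.coe_lt_coe.2 (hno i hiA hne hLi)
  rw [eq_neg_of_add_eq_zero_right hsum, val.map_neg, hv1] at hlt
  exact lt_irrefl _ hlt

theorem exists_eval_lt_of_singular {A B : Finset (Fin d → ℤ)} {p : (Fin d → ℤ) → ℝ}
    {σ : Set (Fin d → ℤ)} {z₀ i₁ : Fin d → ℤ} {L : IntAffine d} (hL : 0 < L.eval i₁)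
    {μ : (Fin d → ℤ) → (Fin d → ℤ) → ℚ}
    (h0 : ∀ i, ∑ z ∈ B, μ i z + (L.eval i / L.eval i₁ : ℚ) = 1)
    (h1 : ∀ i k, ∑ z ∈ B, μ i z * (z k : ℚ) + (L.eval i / L.eval i₁ : ℚ) * i₁ k = i k)
    (hσ : ∀ i ∈ σ, i ≠ i₁ → L.eval i = 0) (hi₁ : i₁ ∈ σ) (hB : ∀ z ∈ B, z ∈ σ)
    (hz₀ : z₀ ∈ σ) (hLB : ∀ z ∈ B, L.eval z = 0) (hLz₀ : L.eval z₀ = 0) {v q : Fin d → ℝ}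
    (hv : minSupport A p v = σ) (hs : IsTropSingular val A p q)
    (hq : q ∈ dualCell A p (σ ∩ {i | L.eval i = 0})) (hpos : 0 < pair (i₁ - z₀) (q - v)) :
    ∃ i₂ ∈ A, i₂ ∉ σ ∧ L.eval i₂ ≠ 0 ∧ L.eval i₂ < L.eval i₁ := by
  obtain ⟨c, hc, hc0, hc1⟩ := hs.exists_terms
  have hmem : ∀ i, i ∈ σ ↔ i ∈ A ∧ ∀ j ∈ A, tropTerm p i v ≤ tropTerm p j v :=
    fun i => hv ▸ mem_minSupport_iff
  obtain ⟨i₂, hi₂, hne, hL₂, hle⟩ := exists_tropTerm_le_of_balanced val hc hc0 hc1 L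
    ((hmem i₁).1 hi₁).1 hL.ne'
  have hi₂σ : i₂ ∉ σ := fun h => hL₂ (hσ i₂ h hne)
  refine ⟨i₂, hi₂, hi₂σ, hL₂, ?_⟩
  have hlt : tropTerm p i₁ v < tropTerm p i₂ v := by
    by_contra hge
    push Not at hge
    exact hi₂σ ((hmem i₂).2 ⟨hi₂, fun j hj => hge.trans (((hmem i₁).1 hi₁).2 j hj)⟩)
  have hpair : ∀ z ∈ B, pair z (q - v) = pair z₀ (q - v) := fun z hz => by
    have e1 : tropTerm p z v = tropTerm p z₀ v :=
      le_antisymm (((hmem z).1 (hB z hz)).2 _ ((hmem z₀).1 hz₀).1)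
        (((hmem z₀).1 hz₀).2 _ ((hmem z).1 (hB z hz)).1)
    have e2 := tropTerm_eq_of_mem_dualCell hq (i := z) (j := z₀) ⟨hB z hz, hLB z hz⟩ ⟨hz₀, hLz₀⟩
    simp only [tropTerm] at e1 e2
    rw [pair_sub_right, pair_sub_right]
    linarith
  have e := pair_eq_of_eq_on h0 h1 hpair i₂
  rw [← pair_sub_left] at e
  have hr : ((L.eval i₂ / L.eval i₁ : ℚ) : ℝ) < 1 := by
    by_contra hge
    push Not at hge
    -- With `r i₂ ≥ 1` the gap of `i₂` over `i₁`, positive at `v`, could not close on the way to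
    -- `q`.
    have hmul := le_mul_of_one_le_left hpos.le hge
    rw [pair_sub_left] at hmul e
    simp only [pair_sub_right] at hmul e
    simp only [tropTerm] at hle hlt
    linarith
  have hr' : (L.eval i₂ / L.eval i₁ : ℚ) < 1 := by exact_mod_cast hr
  rw [div_lt_one (by exact_mod_cast hL)] at hr'
  exact_mod_cast hr'

theorem exists_singular_of_eval_lt [IsAlgClosed K] [CharZero K] {A B : Finset (Fin d → ℤ)}
    {p : (Fin d → ℤ) → ℝ} (hp : ∀ i ∈ A, ∃ x : K, val x = ((p i : ℝ) : WithTop ℝ))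
    {σ : Set (Fin d → ℤ)} {z₀ i₁ : Fin d → ℤ} {L : IntAffine d} (hL : 0 < L.eval i₁)
    {μ : (Fin d → ℤ) → (Fin d → ℤ) → ℚ}
    (h0 : ∀ i, ∑ z ∈ B, μ i z + (L.eval i / L.eval i₁ : ℚ) = 1)
    (h1 : ∀ i k, ∑ z ∈ B, μ i z * (z k : ℚ) + (L.eval i / L.eval i₁ : ℚ) * i₁ k = i k)
    (hμ : ∀ z ∈ B, μ z₀ z ≠ 0) (hz₀B : z₀ ∉ B) (hBne : B.Nonempty)
    (hσ : ∀ i ∈ σ, i ≠ i₁ → L.eval i = 0) (hi₁ : i₁ ∈ σ) (hB : ∀ z ∈ B, z ∈ σ)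
    (hz₀ : z₀ ∈ σ) (hLB : ∀ z ∈ B, L.eval z = 0) (hLz₀ : L.eval z₀ = 0) {v : Fin d → ℝ}
    (hv : minSupport A p v = σ)
    (hex : ∃ i₂ ∈ A, i₂ ∉ σ ∧ L.eval i₂ ≠ 0 ∧ L.eval i₂ < L.eval i₁) :
    ∃ q : Fin d → ℝ, IsTropSingular val A p q ∧
      q ∈ dualCell A p (σ ∩ {i | L.eval i = 0}) ∧
      ∀ z, L.eval z = 0 → 0 < pair (i₁ - z) (q - v) := by
  classical
  have hLq : (0 : ℚ) < L.eval i₁ := by exact_mod_cast hL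
  set r : (Fin d → ℤ) → ℚ := fun i => (L.eval i / L.eval i₁ : ℚ) with hr
  have hr1 : r i₁ = 1 := div_self hLq.ne'
  have hr0 : ∀ i, r i = 0 ↔ L.eval i = 0 := fun i => by simp [hr, hL.ne']
  have hrlt : ∀ i, r i < 1 ↔ L.eval i < L.eval i₁ := fun i => by
    rw [hr, div_lt_one hLq]; exact_mod_cast Iff.rfl
  have hmem : ∀ i, i ∈ σ ↔ i ∈ A ∧ ∀ j ∈ A, tropTerm p i v ≤ tropTerm p j v :=
    fun i => hv ▸ mem_minSupport_iff
  set m := tropTerm p i₁ v with hm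
  have hge : ∀ i ∈ A, m ≤ tropTerm p i v := ((hmem i₁).1 hi₁).2
  have heq : ∀ i ∈ A, tropTerm p i v = m ↔ i ∈ σ := fun i hi => by
    constructor
    · intro h
      exact (hmem i).2 ⟨hi, fun j hj => h ▸ hge j hj⟩
    · intro h
      exact le_antisymm (((hmem i).1 h).2 _ ((hmem i₁).1 hi₁).1) (hge i hi)
  have hσA : ∀ i ∈ σ, i ∈ A := fun i hi => ((hmem i).1 hi).1
  have hgt : ∀ i ∈ A, i ∉ σ → m < tropTerm p i v := fun i hi hiσ =>
    lt_of_le_of_ne (hge i hi) fun h => hiσ ((heq i hi).1 h.symm)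
  let I := A.filter fun i => i ∉ σ ∧ L.eval i ≠ 0 ∧ L.eval i < L.eval i₁
  have hI : I.Nonempty := by
    obtain ⟨i, hi, h⟩ := hex
    exact ⟨i, Finset.mem_filter.2 ⟨hi, h⟩⟩
  -- The time at which `i` catches `i₁`, if the monomial of `i` changes at rate `r i` up to a common
  -- shift.
  let τ : (Fin d → ℤ) → ℝ := fun i => (tropTerm p i v - m) / (1 - r i)
  obtain ⟨i₂, hi₂I, hmin⟩ := I.exists_min_image τ hI
  obtain ⟨hi₂, hi₂σ, hL₂, hlt₂⟩ := Finset.mem_filter.1 hi₂I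
  have hden : ∀ i, L.eval i < L.eval i₁ → (0 : ℝ) < 1 - r i := fun i hi => by
    have := (hrlt i).2 hi
    rw [sub_pos]
    exact_mod_cast this
  set N := τ i₂ with hN
  have hNpos : 0 < N := div_pos (sub_pos.2 (hgt i₂ hi₂ hi₂σ)) (hden i₂ hlt₂)
  set Γ := valueSpace val
  have hpΓ : ∀ i ∈ A, p i ∈ Γ := fun i hi => hp i hi
  have hvΓ : ∀ k, v k ∈ Γ := mem_submodule_of_tropTerm_eq h0 h1
    (fun z hz => (heq z (hσA z (hB z hz))).2 (hB z hz)) rfl Γ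
    (fun z hz => hpΓ z (hσA z (hB z hz))) (hpΓ i₁ (hσA i₁ hi₁))
  have hpairΓ : ∀ (u : Fin d → ℝ), (∀ k, u k ∈ Γ) → ∀ i, pair i u ∈ Γ := fun u hu i =>
    Γ.sum_mem fun k _ => by
      have := Γ.smul_mem (i k : ℚ) (hu k)
      rwa [Rat.smul_def, Rat.cast_intCast] at this
  have htermΓ : ∀ (u : Fin d → ℝ), (∀ k, u k ∈ Γ) → ∀ i ∈ A, tropTerm p i u ∈ Γ :=
    fun u hu i hi => Γ.add_mem (hpΓ i hi) (hpairΓ u hu i)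
  have hNΓ : N ∈ Γ := by
    have : N = (1 - r i₂)⁻¹ • (tropTerm p i₂ v - m) := by
      rw [Rat.smul_def, hN]
      push_cast
      simp only [τ]
      rw [div_eq_inv_mul]
    rw [this]
    exact Γ.smul_mem _ (Γ.sub_mem (htermΓ v hvΓ i₂ hi₂) (htermΓ v hvΓ i₁ (hσA i₁ hi₁)))
  set q : Fin d → ℝ := fun k => v k + ((L.lin k / L.eval i₁ : ℚ) : ℝ) * N with hq
  have hqΓ : ∀ k, q k ∈ Γ := fun k => by
    have := Γ.smul_mem (L.lin k / L.eval i₁ : ℚ) hNΓ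
    rw [Rat.smul_def] at this
    exact Γ.add_mem (hvΓ k) this
  set e : ℝ := ((L.const / L.eval i₁ : ℚ) : ℝ) * N with he
  have hpq : ∀ i, pair i (q - v) = r i * N - e := fun i => by
    have hLe : (r i : ℚ) = ∑ k, (i k : ℚ) * (L.lin k / L.eval i₁ : ℚ) + L.const / L.eval i₁ := by
      simp only [hr, IntAffine.eval]
      push_cast
      rw [add_div, Finset.sum_div]
      congr 1
      exact Finset.sum_congr rfl fun k _ => by ring
    rw [he, ← sub_mul, ← Rat.cast_sub, hLe, add_sub_cancel_right, pair]
    push_cast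
    rw [Finset.sum_mul]
    exact Finset.sum_congr rfl fun k _ => by simp [hq]; ring
  have htq : ∀ i, tropTerm p i q = tropTerm p i v + r i * N - e := fun i => by
    have := hpq i
    rw [pair_sub_right] at this
    simp only [tropTerm]
    linarith
  -- For `r i < 1` this is minimality of the catching time `N`; for `r i ≥ 1` the monomial starts at
  -- or above that of `i₁` and rises at least as fast.
  have hPs : ∀ i ∈ A, r i ≠ 0 → m + N - e ≤ tropTerm p i q := fun i hi hri => by
    rw [htq]
    have hLi : L.eval i ≠ 0 := fun h => hri ((hr0 i).2 h)
    by_cases hlt : L.eval i < L.eval i₁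
    · have hiσ : i ∉ σ := fun h => hLi (hσ i h fun hh => hlt.ne (by rw [hh]))
      have := hmin i (Finset.mem_filter.2 ⟨hi, hiσ, hLi, hlt⟩)
      simp only [τ] at this
      rw [le_div_iff₀ (hden i hlt)] at this
      linarith
    · have h1 : (1 : ℝ) ≤ r i := by
        have := mt (hrlt i).1 hlt
        push Not at this
        exact_mod_cast this
      have := le_mul_of_one_le_left hNpos.le h1
      have := hge i hi
      linarith
  have hP0 : ∀ i, r i = 0 → tropTerm p i q = tropTerm p i v - e := fun i hi => by
    rw [htq, hi]; simp
  have hPσ : ∀ i ∈ σ, L.eval i = 0 → tropTerm p i q = m - e := fun i hi hLi => by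
    rw [hP0 i ((hr0 i).2 hLi), (heq i (hσA i hi)).2 hi]
  have hPm : ∀ i ∈ A, m - e ≤ tropTerm p i q := fun i hi => by
    by_cases hri : r i = 0
    · rw [hP0 i hri]
      linarith [hge i hi]
    · linarith [hPs i hi hri]
  have hms : minSupport A p q = σ ∩ {i | L.eval i = 0} := by
    ext i
    rw [mem_minSupport_iff]
    constructor
    · rintro ⟨hi, hle⟩
      have hle0 := hle z₀ (hσA z₀ hz₀)
      rw [hPσ z₀ hz₀ hLz₀] at hle0
      have hri : r i = 0 := by
        by_contra hri
        linarith [hPs i hi hri]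
      refine ⟨(heq i hi).1 (le_antisymm ?_ (hge i hi)), (hr0 i).1 hri⟩
      rw [hP0 i hri] at hle0
      linarith
    · rintro ⟨hi, hLi⟩
      exact ⟨hσA i hi, fun j hj => by rw [hPσ i hi hLi]; exact hPm j hj⟩
  have hqT : q ∈ tropHypersurface A p := by
    obtain ⟨z, hz⟩ := hBne
    refine ⟨z₀, ?_, z, ?_, fun h => hz₀B (h ▸ hz)⟩
    · rw [hms]; exact ⟨hz₀, hLz₀⟩
    · rw [hms]; exact ⟨hB z hz, hLB z hz⟩
  have hP₁ : tropTerm p i₁ q = m + N - e := by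
    rw [htq, hr1]; simp [hm]
  have hP₂ : tropTerm p i₂ q = m + N - e := by
    rw [htq]
    have : N * (1 - r i₂) = tropTerm p i₂ v - m := div_mul_cancel₀ _ (hden i₂ hlt₂).ne'
    linarith
  have hne : ∀ {i j : Fin d → ℤ}, L.eval i = 0 → L.eval j ≠ 0 → i ≠ j := fun h h' hh =>
    h' (hh ▸ h)
  obtain ⟨c, hc, hc0, hc1⟩ := exists_balanced_terms val (A := A) (B := B) (z₀ := z₀) (i₁ := i₁)
    (i₂ := i₂) (fun z hz => hσA z (hB z hz)) (hσA z₀ hz₀) (hσA i₁ hi₁) hi₂ hz₀B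
    (fun h => hL.ne' (hLB _ h)) (fun h => hL₂ (hLB _ h)) (hne hLz₀ hL.ne') (hne hLz₀ hL₂)
    (fun h => hlt₂.ne (by rw [h])) μ r h0 h1 hμ ((hr0 z₀).2 hLz₀) (fun h => hL₂ ((hr0 i₂).1 h))
    (fun i => tropTerm p i q) (fun i hi => htermΓ q hqΓ i hi)
    (fun z hz => hPσ z (hB z hz) (hLB z hz)) (hPσ z₀ hz₀ hLz₀) hPm hP₁ hP₂ hPs
  refine ⟨q, IsTropSingular.of_terms hqT (fun k => hqΓ k) c hc hc0 hc1,
    subset_closure ⟨hqT, hms⟩, fun z hz => ?_⟩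
  rw [pair_sub_left, hpq, hpq, hr1, (hr0 z).2 hz]
  simpa using hNpos

end Singular

end TropSing

/-! ### The proposition -/

open TropSing in
theorem mainTheorem6 {K : Type*} [Field K] [IsAlgClosed K] [CharZero K]
    (val : AddValuation K (WithTop ℝ))
    (hval : ∃ x : K, x ≠ 0 ∧ val x ≠ 0)
    [CharZero (IsLocalRing.ResidueField (AddValuation.toValuation val).valuationSubring)]
    {d : ℕ} (A : Finset (Fin d → ℤ)) (p : (Fin d → ℤ) → ℝ)
    (hp : ∀ i ∈ A, ∃ x : K, val x = ((p i : ℝ) : WithTop ℝ))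
    (σ' : Set (Fin d → ℤ)) (hσ' : TropSing.IsMarkedCell A p σ') (hdim : TropSing.affDim σ' = d)
    (i₁ : Fin d → ℤ) (hpyr : TropSing.IsPyramidOver σ' i₁)
    (Z : Set (Fin d → ℤ)) (hZ : TropSing.IsCircuit Z) (hZdim : TropSing.affDim Z + 1 = d)
    (L : TropSing.IntAffine d) (hZL : Z ⊆ σ' ∩ {i | L.eval i = 0}) (hL : 0 < L.eval i₁)
    (v : Fin d → ℝ) (hv : v ∈ TropSing.dualCell A p σ') :
    ((∃ q : Fin d → ℝ, TropSing.IsTropSingular val A p q ∧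
        q ∈ TropSing.dualCell A p (σ' ∩ {i | L.eval i = 0}) ∧
        ∀ z ∈ Z, 0 < TropSing.pair (i₁ - z) (q - v)) ↔
      ∃ i₂ ∈ A, i₂ ∉ σ' ∧ L.eval i₂ ≠ 0 ∧ L.eval i₂ < L.eval i₁) ∧
    ((interior (convexHull ℝ (TropSing.toReal '' (A : Set (Fin d → ℤ)))) ∩
        convexHull ℝ (TropSing.toReal '' Z)).Nonempty →
      ∃ q : Fin d → ℝ, TropSing.IsTropSingular val A p q) := by
  have hL0 : ∀ z ∈ Z, L.eval z = 0 := fun z hz => (hZL hz).2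
  obtain ⟨w, -, hw⟩ := closure_nonempty_iff.1 ⟨v, hv⟩
  have hZA : Z ⊆ A := fun z hz => (mem_minSupport_iff.1 (hw ▸ (hZL hz).1)).1
  obtain ⟨z₀, hz₀, B, hB, μ, h0, h1, hμ⟩ := exists_affine_coordinates hZ
    (A.finite_toSet.subset hZA) hZdim L hL0 hL.ne'
  have hBZ : ∀ z ∈ B, z ∈ Z ∧ z ≠ z₀ := fun z hz => by
    rw [← Finset.mem_coe, hB] at hz; exact hz
  have hBσ : ∀ z ∈ B, z ∈ σ' := fun z hz => (hZL (hBZ z hz).1).1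
  have hBL : ∀ z ∈ B, L.eval z = 0 := fun z hz => hL0 z (hBZ z hz).1
  have hBne : B.Nonempty := by
    obtain ⟨y, hy, hne⟩ := hZ.nontrivial.exists_ne z₀
    exact ⟨y, by rw [← Finset.mem_coe, hB]; exact ⟨hy, hne⟩⟩
  have hσ : ∀ i ∈ σ', i ≠ i₁ → L.eval i = 0 := fun i hi hne => by
    have := hpyr.coordinate_eq_zero h0 h1 (fun z hz => ⟨hBσ z hz,
      fun h => hL.ne' (h ▸ hBL z hz), by rw [hBL z hz]; simp⟩) hi hne
    simpa [hL.ne'] using this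
  have hmin := minSupport_eq_of_mem_dualCell h0 h1 hBσ hpyr.1 hv
  have hsing := exists_singular_of_eval_lt val hp hL h0 h1 hμ (fun h => (hBZ z₀ h).2 rfl) hBne hσ
    hpyr.1 hBσ (hZL hz₀).1 hBL (hL0 z₀ hz₀) hmin
  refine ⟨⟨?_, fun hex => ?_⟩, fun hint => ?_⟩
  · rintro ⟨q, hq, hqd, hpos⟩
    exact exists_eval_lt_of_singular val hL h0 h1 hσ hpyr.1 hBσ (hZL hz₀).1 hBL (hL0 z₀ hz₀) hmin
      hq hqd (hpos z₀ hz₀)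
  · obtain ⟨q, hq, hqd, hpos⟩ := hsing hex
    exact ⟨q, hq, hqd, fun z hz => hpos z (hL0 z hz)⟩
  · have hlin : L.lin ≠ 0 := fun h => by
      have e := hL0 z₀ hz₀
      simp only [IntAffine.eval, h, Pi.zero_apply, zero_mul, Finset.sum_const_zero,
        zero_add] at e hL
      exact hL.ne' e
    obtain ⟨i, hi, hneg⟩ := exists_eval_neg_of_mem_interior hL0 hlin hint
    -- A point with `L < 0` lies outside `σ'`, where `L` vanishes except at `i₁`, and `L(i₁) > 0`.
    obtain ⟨q, hq, -⟩ := hsing ⟨i, hi, fun h => hneg.ne (hσ i h fun hh => by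
      rw [hh] at hneg; exact lt_asymm hL hneg), hneg.ne, hneg.trans hL⟩
    exact ⟨q, hq⟩
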